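/- Let $f(z)=\sum_{j=0}^{\infty}a_jz^j$, $a_j\in\mathbb{R}$, be a real entire function which has a Weierstrass factorization $$f(z)=z^{p}e^{Bz+C}\prod_{j}\left(1-\frac{z}{z_j}\right)e^{z/z_j},$$ where $p\ge 0$ is an integer, $B,C\in\mathbb{C}$, and $(z_j)$ is a finite (possibly empty) or infinite family of nonzero complex numbers, the zeros of $f$ other than the origin repeated according to multiplicity. Suppose that $\sum_{j}1/|z_j|$ converges, that $B+\sum_{j}1/z_j$ is real and positive, and that every zero $w\neq0$ of $f$ lies in the sector $2\pi/3<|\operatorname{Arg}w|\le\pi$, where $\operatorname{Arg}$ is the principal argument, $-\pi<\operatorname{Arg}w\le\pi$. Then, for each $r\in\{0,1,2\}$, every zero $w\in\mathbb{C}$ of the entire function $$f_r(z)=\sum_{j\equiv r\ (\mathrm{mod}\ 3)}a_jz^j$$ lies on the three rays $\operatorname{Im}w^3=0$, $\operatorname{Re}w^3\le0$. -/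

import Mathlib

open scoped ComplexOrder

/-- The sector `2π/3 < |Arg w| ≤ π`, where `Arg` is the principal argument,
`-π < Arg w ≤ π`. As `Complex.arg 0 = 0`, the origin does not belong to it. -/
def leftSector : Set ℂ :=
  {w : ℂ | 2 * Real.pi / 3 < |w.arg| ∧ |w.arg| ≤ Real.pi}

/-- The three rays `Im w³ = 0`, `Re w³ ≤ 0` (the origin included). -/
def cubicRays : Set ℂ :=
  {w : ℂ | (w ^ 3).im = 0 ∧ (w ^ 3).re ≤ 0}

/-- `w ↦ ∑_{j ≡ r (mod m)} a_j w^j`. -/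
noncomputable def arithSection (a : ℕ → ℝ) (m r : ℕ) (w : ℂ) : ℂ :=
  ∑' j : ℕ, if j ≡ r [MOD m] then (a j : ℂ) * w ^ j else 0

/-!
Fix `w ≠ 0` with `θ = arg w ∈ [0, π/3)`; it is enough to show that no section `f_r` vanishes at such
a `w`, because `w ↦ w'` with `w' ^ 3 = w ^ 3` only multiplies `f_r(w)` by a nonzero constant, and
`f_r` commutes with conjugation.

The sections of `f` at `w` form a triple `v : ZMod 3 → ℂ`, an inverse discrete Fourier transform
(`trisect`), so that products of functions become cyclic convolutions of triples (`trisect_mul`).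
Call a triple *interlaced* if `v r = ρ r * exp (i φ r)` with `ρ r > 0` and real lifts `φ` satisfying
`φ (r + 1) ≤ φ r + θ` cyclically. This is a pointwise substitute for the interlacing, on the
negative axis, of the zeros of the three sections as functions of `w ^ 3`.

* Multiplication by `c + b z + d z ^ 2` with nonnegative coefficients and `c d ≤ b ^ 2` preserves
  interlaced triples (`IsInterlaced.quadratic_step`): a Cauchy-Binet expansion writes the relevant
  imaginary part as a combination of nonnegative ones, and `b ^ 2 - c d` is the only minor whose sign
  is in question. For `(1 - z / ζ) (1 - z / conj ζ)` and `ζ` in the left half-plane this inequality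
  says exactly `|Arg ζ| ≥ 2π/3`.
* In the convolution of two interlaced triples all terms lie in a cone of opening at most `3 θ < π`,
  so that they cannot cancel (`IsInterlaced.cos_mul_le_norm_convolution`).

Up to a constant, `f` is the product of `exp (δ z)` and `z ^ p exp ((β - δ) z) ∏ (1 - z / z_i)`, and
both factors are limits of polynomials with interlaced triples. The lower bound of the second point
survives the limit. For small `δ` no component of the triple of `exp (δ z)` vanishes, and the second
factor has some nonzero component because it does not vanish at `w`. Hence `f_r(w) ≠ 0`
(`trisect_ne_zero`).

The zeros have to be grouped into conjugate pairs. As `f` is real, `ζ` and `conj ζ` are zeros of the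
same order, and the order at `ζ` is the number of indices with `z i = ζ`
(`analyticOrderAt_tprod_one_sub_div`, `ncard_conj_eq_of_real`).
-/

open Complex ZMod Filter Topology ComplexConjugate

/-! ### Sums of complex numbers in a cone -/

section Cone

variable {ι : Type*} [Fintype ι] {t α : ι → ℝ} {m h : ℝ}

theorem sum_rotate (t α : ι → ℝ) (m : ℝ) :
    (∑ i, (t i : ℂ) * cexp (α i * I)) * cexp (-m * I) =
      ∑ i, (t i : ℂ) * cexp ((α i - m : ℝ) * I) := by
  rw [Finset.sum_mul]
  refine Finset.sum_congr rfl fun i _ => ?_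
  rw [mul_assoc, ← Complex.exp_add]
  push_cast
  ring_nf

theorem re_ofReal_mul_exp (t x : ℝ) : ((t : ℂ) * cexp (x * I)).re = t * Real.cos x := by
  rw [re_ofReal_mul, exp_ofReal_mul_I_re]

theorem im_ofReal_mul_exp (t x : ℝ) : ((t : ℂ) * cexp (x * I)).im = t * Real.sin x := by
  rw [im_ofReal_mul, exp_ofReal_mul_I_im]

/-- Vectors in a cone of half-opening `h ≤ π / 2` around the direction `m` cannot cancel: the
projection to the axis of the cone is at least `cos h` times the length of each of them. -/
theorem cos_mul_le_norm_sum (ht : ∀ i, 0 ≤ t i) (hα : ∀ i, |α i - m| ≤ h) (hh : h ≤ Real.pi / 2)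
    (i : ι) : Real.cos h * t i ≤ ‖∑ i, (t i : ℂ) * cexp (α i * I)‖ := by
  have hcos : ∀ i, Real.cos h ≤ Real.cos (α i - m) := fun i => by
    rw [← Real.cos_abs (α i - m)]
    exact Real.cos_le_cos_of_nonneg_of_le_pi (abs_nonneg _) (by linarith [Real.pi_pos]) (hα i)
  have h0 : 0 ≤ Real.cos h := Real.cos_nonneg_of_mem_Icc
    ⟨by linarith [Real.pi_pos, (abs_nonneg _).trans (hα i)], hh⟩
  have hn : ‖cexp (-m * I)‖ = 1 := by
    simpa using norm_exp_ofReal_mul_I (-m)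
  rw [← mul_one ‖_‖, ← hn, ← norm_mul, sum_rotate]
  refine le_trans ?_ (re_le_norm _)
  rw [re_sum]
  calc Real.cos h * t i ≤ t i * Real.cos (α i - m) := by
        rw [mul_comm]; exact mul_le_mul_of_nonneg_left (hcos i) (ht i)
    _ ≤ _ := by
        simp_rw [re_ofReal_mul_exp]
        exact Finset.single_le_sum (f := fun i => t i * Real.cos (α i - m))
          (fun j _ => mul_nonneg (ht j) (h0.trans (hcos j))) (Finset.mem_univ i)

/-- A nonempty sum of vectors in an acute cone lies in the cone, with an argument lifted to the same
interval of real numbers as the arguments `α i`. -/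
theorem exists_polar_sum (ht : ∀ i, 0 ≤ t i) (hα : ∀ i, |α i - m| ≤ h) (hh : h < Real.pi / 2)
    (hpos : ∃ i, 0 < t i) :
    ∃ σ ψ : ℝ, 0 < σ ∧ |ψ - m| ≤ h ∧ ∑ i, (t i : ℂ) * cexp (α i * I) = σ * cexp (ψ * I) := by
  obtain ⟨i₀, hi₀⟩ := hpos
  have hh0 : 0 ≤ h := (abs_nonneg _).trans (hα i₀)
  set y : ℂ := ∑ i, (t i : ℂ) * cexp ((α i - m : ℝ) * I) with hy
  have hx : ∑ i, (t i : ℂ) * cexp (α i * I) = y * cexp (m * I) := by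
    rw [hy, ← sum_rotate, mul_assoc, ← Complex.exp_add]
    simp
  have hcos : ∀ i, 0 < Real.cos (α i - m) := fun i => by
    refine Real.cos_pos_of_mem_Ioo ⟨?_, ?_⟩ <;> linarith [abs_le.1 (hα i)]
  have hre : 0 < y.re := by
    rw [hy, re_sum]
    simp_rw [re_ofReal_mul_exp]
    exact Finset.sum_pos' (fun i _ => mul_nonneg (ht i) (hcos i).le)
      ⟨i₀, Finset.mem_univ _, mul_pos hi₀ (hcos i₀)⟩
  have hy0 : y ≠ 0 := fun h0 => by simp [h0] at hre
  have hσ : 0 < ‖y‖ := norm_pos_iff.2 hy0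
  have harg : |y.arg| < Real.pi / 2 := abs_arg_lt_pi_div_two_iff.2 (Or.inl hre)
  have hre' : y.re = ‖y‖ * Real.cos y.arg := (norm_mul_cos_arg y).symm
  have him' : y.im = ‖y‖ * Real.sin y.arg := (norm_mul_sin_arg y).symm
  have hsum_re : y.re = ∑ i, t i * Real.cos (α i - m) := by
    rw [hy, re_sum]; simp_rw [re_ofReal_mul_exp]
  have hsum_im : y.im = ∑ i, t i * Real.sin (α i - m) := by
    rw [hy, im_sum]; simp_rw [im_ofReal_mul_exp]
  -- `ε = 1` and `ε = -1` treat the two sides of the cone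
  have key : ∀ ε : ℝ, ε = 1 ∨ ε = -1 → 0 ≤ Real.sin (h + ε * y.arg) := by
    intro ε hε
    have e1 : ∀ x, Real.sin (h + ε * x) = Real.sin h * Real.cos x + ε * (Real.cos h * Real.sin x) := by
      intro x
      rcases hε with rfl | rfl
      · rw [one_mul, Real.sin_add]; ring
      · rw [neg_one_mul, ← sub_eq_add_neg, Real.sin_sub]; ring
    have e2 : ‖y‖ * Real.sin (h + ε * y.arg) = ∑ i, t i * Real.sin (h + ε * (α i - m)) := by
      simp_rw [e1]
      calc _ = Real.sin h * y.re + ε * Real.cos h * y.im := by rw [hre', him']; ring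
        _ = _ := by
          rw [hsum_re, hsum_im, Finset.mul_sum, Finset.mul_sum, ← Finset.sum_add_distrib]
          exact Finset.sum_congr rfl fun i _ => by ring
    refine nonneg_of_mul_nonneg_right ?_ hσ
    rw [e2]
    refine Finset.sum_nonneg fun i _ => mul_nonneg (ht i) ?_
    have := abs_le.1 (hα i)
    apply Real.sin_nonneg_of_nonneg_of_le_pi <;> rcases hε with rfl | rfl <;> linarith
  have key2 : ∀ ε : ℝ, ε = 1 ∨ ε = -1 → 0 ≤ h + ε * y.arg := by
    intro ε hε
    by_contra! hlt
    refine absurd (key ε hε) (not_le.2 (Real.sin_neg_of_neg_of_neg_pi_lt hlt ?_))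
    have := abs_lt.1 harg
    rcases hε with rfl | rfl <;> linarith
  refine ⟨‖y‖, m + y.arg, hσ, ?_, ?_⟩
  · have h1 := key2 1 (Or.inl rfl)
    have h2 := key2 (-1) (Or.inr rfl)
    rw [abs_le]; constructor <;> linarith
  · rw [hx]
    conv_lhs => rw [← norm_mul_exp_arg_mul_I y]
    rw [mul_assoc, ← Complex.exp_add]
    push_cast
    ring_nf

end Cone

/-! ### The three sections of a function as a discrete Fourier transform -/

section Trisect

/-- The values at `w` of the three sections of `g`, indexed by the residue of the exponents
modulo `3`. It is defined for an arbitrary function `g` by averaging over the cube roots of unity;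
for an entire function it agrees with the sections of the power series, see
`trisect_eq_arithSection`. -/
noncomputable def trisect (g : ℂ → ℂ) (w : ℂ) : ZMod 3 → ℂ :=
  dft.symm fun k => g (stdAddChar (-k) * w)

theorem trisect_eq_iff {g : ℂ → ℂ} {w : ℂ} {G : ZMod 3 → ℂ} :
    trisect g w = G ↔ ∀ k, ∑ r, stdAddChar (-(r * k)) * G r = g (stdAddChar (-k) * w) := by
  rw [trisect, LinearEquiv.symm_apply_eq, funext_iff]
  exact forall_congr' fun k => by rw [dft_apply]; exact eq_comm

theorem sum_stdAddChar_mul_trisect (g : ℂ → ℂ) (w : ℂ) (k : ZMod 3) :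
    ∑ r, stdAddChar (-(r * k)) * trisect g w r = g (stdAddChar (-k) * w) :=
  trisect_eq_iff.1 rfl k

theorem trisect_apply (g : ℂ → ℂ) (w : ℂ) (r : ZMod 3) :
    trisect g w r = 3⁻¹ * ∑ k, stdAddChar (k * r) * g (stdAddChar (-k) * w) := by
  rw [trisect, invDFT_apply]
  simp

/-- The sections of a product are the cyclic convolution of the sections of the factors. -/
theorem trisect_mul (g h : ℂ → ℂ) (w : ℂ) (r : ZMod 3) :
    trisect (g * h) w r = ∑ s, trisect g w s * trisect h w (r - s) := by
  revert r
  rw [← funext_iff, trisect_eq_iff]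
  intro k
  rw [Pi.mul_apply, ← sum_stdAddChar_mul_trisect g, ← sum_stdAddChar_mul_trisect h,
    Finset.sum_mul]
  simp_rw [Finset.mul_sum]
  rw [Finset.sum_comm]
  refine Finset.sum_congr rfl fun s _ => ?_
  refine Fintype.sum_equiv (Equiv.subRight s) _ _ fun r => ?_
  have : stdAddChar (-(r * k)) = stdAddChar (-(s * k)) * stdAddChar (-((r - s) * k)) := by
    rw [← AddChar.map_add_eq_mul]; ring_nf
  rw [Equiv.subRight_apply, this]
  ring

/-- The polynomial function `c + b z + d z ^ 2` with real coefficients. -/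
def quadratic (c b d : ℝ) : ℂ → ℂ := fun z => c + b * z + d * z ^ 2

theorem trisect_quadratic (c b d : ℝ) (w : ℂ) :
    trisect (quadratic c b d) w =
      fun r => ((if r = 0 then c else if r = 1 then b else d : ℝ) : ℂ) * w ^ r.val := by
  rw [trisect_eq_iff]
  intro k
  have e : (stdAddChar (-k) : ℂ) ^ 2 = stdAddChar (-(2 * k)) := by
    rw [← AddChar.map_nsmul_eq_pow]; ring_nf
  refine (Fin.sum_univ_three _).trans ?_
  change stdAddChar (-((0 : ZMod 3) * k)) * (c * w ^ 0) + stdAddChar (-((1 : ZMod 3) * k)) * (b * w ^ 1)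
    + stdAddChar (-((2 : ZMod 3) * k)) * (d * w ^ 2) = _
  rw [quadratic, mul_pow, e]
  simp
  ring

theorem trisect_quadratic_mul (c b d : ℝ) (g : ℂ → ℂ) (w : ℂ) (r : ZMod 3) :
    trisect (quadratic c b d * g) w r =
      c * trisect g w r + b * w * trisect g w (r - 1) + d * w ^ 2 * trisect g w (r - 2) := by
  rw [trisect_mul, trisect_quadratic]
  refine (Fin.sum_univ_three _).trans ?_
  change (c * w ^ 0) * trisect g w (r - 0) + (b * w ^ 1) * trisect g w (r - 1)
    + (d * w ^ 2) * trisect g w (r - 2) = _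
  simp

theorem tendsto_trisect {β : Type*} {l : Filter β} {G : β → ℂ → ℂ} {g : ℂ → ℂ}
    (h : ∀ z, Tendsto (fun n => G n z) l (𝓝 (g z))) (w : ℂ) (r : ZMod 3) :
    Tendsto (fun n => trisect (G n) w r) l (𝓝 (trisect g w r)) := by
  simp_rw [trisect_apply]
  exact (tendsto_finsetSum _ fun k _ => (h _).const_mul _).const_mul _

theorem exists_trisect_ne_zero {g : ℂ → ℂ} {w : ℂ} (h : g w ≠ 0) : ∃ s, trisect g w s ≠ 0 := by
  by_contra! h0
  have := sum_stdAddChar_mul_trisect g w 0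
  simp [h0] at this
  exact h this.symm

end Trisect

/-! ### Interlaced triples -/

section Interlaced

/-- A triple of nonzero complex numbers whose arguments can be lifted to real numbers `φ r` with
`φ (r + 1) ≤ φ r + θ` for all `r` modulo `3`. -/
def IsInterlaced (θ : ℝ) (v : ZMod 3 → ℂ) : Prop :=
  ∃ ρ φ : ZMod 3 → ℝ, (∀ r, 0 < ρ r) ∧ (∀ r, v r = ρ r * cexp (φ r * I)) ∧
    ∀ r, φ (r + 1) ≤ φ r + θ

/-- A Cauchy-Binet expansion: up to powers of `|w| ^ 2`, the coefficients on the right are the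
`2 × 2` minors of two consecutive shifts of the row `(d, b, c)`. -/
theorem im_mul_conj_identity (c b d : ℝ) (w x y s : ℂ) :
    (w * (c * x + b * w * y + d * w ^ 2 * s) * conj (c * s + b * w * x + d * w ^ 2 * y)).im =
      c ^ 2 * (w * x * conj s).im + (b ^ 2 - c * d) * normSq w * (w * y * conj x).im +
      d ^ 2 * normSq w ^ 2 * (w * s * conj y).im + b * c * (w ^ 2 * y * conj s).im +
      b * d * normSq w * (w ^ 2 * s * conj x).im + c * d * normSq s * (w ^ 3).im := by
  simp [normSq_apply, pow_succ]
  ring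

theorem polar_mul_conj (ρ σ φ ψ : ℝ) :
    (ρ * cexp (φ * I)) * conj (σ * cexp (ψ * I)) = (ρ * σ : ℝ) * cexp ((φ - ψ : ℝ) * I) := by
  rw [map_mul, conj_ofReal, ← exp_conj, map_mul, conj_I, conj_ofReal]
  push_cast
  rw [sub_mul, sub_eq_add_neg, Complex.exp_add]
  ring_nf

theorem polar_pow_mul_conj (m θ ρ σ φ ψ : ℝ) (k : ℕ) :
    (((m * cexp (θ * I)) ^ k * (ρ * cexp (φ * I))) * conj (σ * cexp (ψ * I))).im =
      m ^ k * ρ * σ * Real.sin (k * θ + φ - ψ) := by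
  have : (m * cexp (θ * I)) ^ k * (ρ * cexp (φ * I)) =
      (m ^ k * ρ : ℝ) * cexp ((k * θ + φ : ℝ) * I) := by
    rw [mul_pow, ← Complex.exp_nat_mul]
    push_cast
    rw [add_mul, Complex.exp_add]
    ring_nf
  rw [this, polar_mul_conj, im_ofReal_mul_exp]

/-- The sections of a product with `c + b z + d z ^ 2` are again interlaced. Each new section is a
positive combination of vectors with arguments `φ r ≤ φ (r - 1) + θ ≤ φ (r - 2) + 2 θ`, which lie in
a cone of opening at most `3 θ < π`; this gives the new lifts `ψ`. The inequality
`ψ (r + 1) ≤ ψ r + θ` holds because the difference is known to exceed `-π` and its sine is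
nonnegative by `im_mul_conj_identity`. -/
theorem IsInterlaced.quadratic_step {θ m c b d : ℝ} {v : ZMod 3 → ℂ} (hθ : 0 ≤ θ)
    (hθ' : θ < Real.pi / 3) (hm : 0 < m) (hc : 0 ≤ c) (hb : 0 ≤ b) (hd : 0 ≤ d)
    (hpos : 0 < c + b + d) (hdisc : c * d ≤ b ^ 2) {w : ℂ} (hw : w = m * cexp (θ * I))
    (hv : IsInterlaced θ v) :
    IsInterlaced θ fun r => c * v r + b * w * v (r - 1) + d * w ^ 2 * v (r - 2) := by
  obtain ⟨ρ, φ, hρ, hvφ, hφ⟩ := hv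
  have e1 : ∀ r : ZMod 3, r - 1 + 1 = r := by decide
  have e2 : ∀ r : ZMod 3, r - 2 + 1 = r - 1 := by decide
  have e3 : ∀ r : ZMod 3, r + 1 = r - 2 := by decide
  have e4 : ∀ r : ZMod 3, r + 1 - 1 = r := by decide
  have e5 : ∀ r : ZMod 3, r + 1 - 2 = r - 1 := by decide
  have hφ1 : ∀ r, φ r ≤ φ (r - 1) + θ := fun r => by simpa [e1] using hφ (r - 1)
  have hφ2 : ∀ r, φ (r - 1) ≤ φ (r - 2) + θ := fun r => by simpa [e2] using hφ (r - 2)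
  have hφ3 : ∀ r, φ (r - 2) ≤ φ r + θ := fun r => by simpa [e3] using hφ r
  have hpol : ∀ r, ∃ σ ψ : ℝ, 0 < σ ∧ (φ r ≤ ψ ∧ ψ ≤ φ (r - 2) + 2 * θ) ∧
      c * v r + b * w * v (r - 1) + d * w ^ 2 * v (r - 2) = σ * cexp (ψ * I) := by
    intro r
    have := hφ1 r; have := hφ2 r; have := hφ3 r
    obtain ⟨σ, ψ, hσ, hψ, h⟩ := exists_polar_sum (ι := Fin 3)
      (t := ![c * ρ r, b * m * ρ (r - 1), d * m ^ 2 * ρ (r - 2)])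
      (α := ![φ r, φ (r - 1) + θ, φ (r - 2) + 2 * θ])
      (m := (φ r + (φ (r - 2) + 2 * θ)) / 2) (h := (φ (r - 2) + 2 * θ - φ r) / 2)
      (by
        have := hρ r; have := hρ (r - 1); have := hρ (r - 2)
        intro i; fin_cases i <;> simp <;> positivity)
      (by
        intro i
        rw [abs_le]
        fin_cases i <;> simp <;> constructor <;> linarith)
      (by linarith)
      (by
        rcases hc.lt_or_eq with hc | rfl
        · exact ⟨0, mul_pos hc (hρ _)⟩
        rcases hb.lt_or_eq with hb | rfl
        · exact ⟨1, mul_pos (mul_pos hb hm) (hρ _)⟩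
        · have hd : 0 < d := by linarith
          exact ⟨2, mul_pos (mul_pos hd (pow_pos hm 2)) (hρ _)⟩)
    refine ⟨σ, ψ, hσ, ?_, ?_⟩
    · rw [abs_le] at hψ
      constructor <;> linarith
    · rw [← h, Fin.sum_univ_three]
      simp only [Matrix.cons_val]
      rw [hvφ r, hvφ (r - 1), hvφ (r - 2), hw, mul_pow, ← Complex.exp_nat_mul]
      push_cast
      simp only [add_mul, Complex.exp_add]
      ring_nf
  choose σ ψ hσ hψ hpol using hpol
  refine ⟨σ, ψ, hσ, hpol, fun r => ?_⟩
  have h1 := hφ1 r; have h2 := hφ2 r; have h3 := hφ3 r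
  have hsin : 0 ≤ Real.sin (θ + ψ r - ψ (r + 1)) := by
    have hnn : 0 ≤ (w * (σ r * cexp (ψ r * I)) * conj (σ (r + 1) * cexp (ψ (r + 1) * I))).im := by
      have hs : ∀ x y : ℝ, 0 < x → 0 ≤ y → y ≤ 3 * θ → 0 ≤ x * Real.sin y := fun x y hx h0 h1 =>
        mul_nonneg hx.le (Real.sin_nonneg_of_nonneg_of_le_pi h0 (by linarith))
      have p1 := hρ r; have p2 := hρ (r - 1); have p3 := hρ (r - 2)
      have hN := normSq_nonneg w
      have hN' := normSq_nonneg (v (r - 2))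
      rw [← hpol, ← hpol, e4, e5, e3, im_mul_conj_identity]
      have k1 : 0 ≤ (w * v r * conj (v (r - 2))).im := by
        have := polar_pow_mul_conj m θ (ρ r) (ρ (r - 2)) (φ r) (φ (r - 2)) 1
        rw [← hw, ← hvφ, ← hvφ, pow_one] at this
        rw [this]
        apply hs _ _ (by positivity) <;> push_cast <;> linarith
      have k2 : 0 ≤ (w * v (r - 1) * conj (v r)).im := by
        have := polar_pow_mul_conj m θ (ρ (r - 1)) (ρ r) (φ (r - 1)) (φ r) 1
        rw [← hw, ← hvφ, ← hvφ, pow_one] at this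
        rw [this]
        apply hs _ _ (by positivity) <;> push_cast <;> linarith
      have k3 : 0 ≤ (w * v (r - 2) * conj (v (r - 1))).im := by
        have := polar_pow_mul_conj m θ (ρ (r - 2)) (ρ (r - 1)) (φ (r - 2)) (φ (r - 1)) 1
        rw [← hw, ← hvφ, ← hvφ, pow_one] at this
        rw [this]
        apply hs _ _ (by positivity) <;> push_cast <;> linarith
      have k4 : 0 ≤ (w ^ 2 * v (r - 1) * conj (v (r - 2))).im := by
        have := polar_pow_mul_conj m θ (ρ (r - 1)) (ρ (r - 2)) (φ (r - 1)) (φ (r - 2)) 2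
        rw [← hw, ← hvφ, ← hvφ] at this
        rw [this]
        apply hs _ _ (by positivity) <;> push_cast <;> linarith
      have k5 : 0 ≤ (w ^ 2 * v (r - 2) * conj (v r)).im := by
        have := polar_pow_mul_conj m θ (ρ (r - 2)) (ρ r) (φ (r - 2)) (φ r) 2
        rw [← hw, ← hvφ, ← hvφ] at this
        rw [this]
        apply hs _ _ (by positivity) <;> push_cast <;> linarith
      have k6 : 0 ≤ (w ^ 3).im := by
        have := polar_pow_mul_conj m θ 1 1 0 0 3
        rw [← hw] at this
        simp only [ofReal_one, ofReal_zero, zero_mul, Complex.exp_zero, mul_one, map_one] at this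
        rw [this]
        have := hs (m ^ 3) (3 * θ) (by positivity) (by linarith) le_rfl
        simpa using this
      have hdisc' : 0 ≤ b ^ 2 - c * d := by linarith
      positivity
    have := polar_pow_mul_conj m θ (σ r) (σ (r + 1)) (ψ r) (ψ (r + 1)) 1
    rw [← hw, pow_one] at this
    rw [this, Nat.cast_one, one_mul, pow_one] at hnn
    exact nonneg_of_mul_nonneg_right hnn (mul_pos (mul_pos hm (hσ r)) (hσ (r + 1)))
  by_contra! hlt
  refine absurd hsin (not_le.2 (Real.sin_neg_of_neg_of_neg_pi_lt (by linarith) ?_))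
  have h4 := (hψ (r + 1)).2
  rw [e5] at h4
  linarith [(hψ r).1]

/-- Terms of the convolution of two interlaced triples do not cancel. -/
theorem IsInterlaced.cos_mul_le_norm_convolution {θ : ℝ} {u v : ZMod 3 → ℂ}
    (hθ' : θ < Real.pi / 3) (hu : IsInterlaced θ u) (hv : IsInterlaced θ v) (r s : ZMod 3) :
    Real.cos (3 * θ / 2) * (‖u s‖ * ‖v (r - s)‖) ≤ ‖∑ s, u s * v (r - s)‖ := by
  obtain ⟨ρ, φ, hρ, huφ, hφ⟩ := hu
  obtain ⟨σ, ψ, hσ, hvψ, hψ⟩ := hv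
  set A : ZMod 3 → ℝ := fun s => φ s + ψ (r - s) with hA
  -- consecutive lifts differ by at most `3 θ`, hence so do any two, as `ZMod 3` has three elements
  have hstep : ∀ s, |A (s + 1) - A s| ≤ 3 * θ := by
    intro s
    have e1 : s + 1 + 1 + 1 = s := (by decide : ∀ s : ZMod 3, s + 1 + 1 + 1 = s) s
    have e2 : r - (s + 1) + 1 = r - s := by ring
    have e3 : r - s + 1 + 1 = r - (s + 1) :=
      (by decide : ∀ r s : ZMod 3, r - s + 1 + 1 = r - (s + 1)) r s
    have h1 := hφ s
    have h2 := hφ (s + 1)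
    have h3 := hφ (s + 1 + 1)
    have h4 := hψ (r - (s + 1))
    have h5 := hψ (r - s)
    have h6 := hψ (r - s + 1)
    rw [e1] at h3; rw [e2] at h4; rw [e3] at h6
    simp only [hA]
    rw [abs_le]; constructor <;> linarith
  have hpair : ∀ s s', A s' - A s ≤ 3 * θ := by
    intro s s'
    have h01 := abs_le.1 (hstep s)
    have h12 := abs_le.1 (hstep (s - 1))
    have h3 : 0 ≤ 3 * θ := (abs_nonneg _).trans (hstep s)
    rw [sub_add_cancel] at h12
    have : s' = s ∨ s' = s + 1 ∨ s' = s - 1 :=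
      (by decide : ∀ s s' : ZMod 3, s' = s ∨ s' = s + 1 ∨ s' = s - 1) s s'
    rcases this with rfl | rfl | rfl
    · simpa using h3
    · linarith
    · linarith
  obtain ⟨i, hi⟩ := Finite.exists_min A
  obtain ⟨j, hj⟩ := Finite.exists_max A
  have key := cos_mul_le_norm_sum (t := fun s => ρ s * σ (r - s)) (α := A)
    (m := (A i + A j) / 2) (h := 3 * θ / 2) (fun s => (mul_pos (hρ _) (hσ _)).le)
    (fun s => by
      have := hi s; have := hj s; have := hpair i j
      rw [abs_le]; constructor <;> linarith) (by linarith) s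
  have hnu : ‖u s‖ = ρ s := by
    rw [huφ, norm_mul, norm_exp_ofReal_mul_I, norm_real, mul_one, Real.norm_of_nonneg (hρ s).le]
  have hnv : ‖v (r - s)‖ = σ (r - s) := by
    rw [hvψ, norm_mul, norm_exp_ofReal_mul_I, norm_real, mul_one, Real.norm_of_nonneg (hσ _).le]
  rw [hnu, hnv]
  refine key.trans (le_of_eq ?_)
  congr 1
  refine Finset.sum_congr rfl fun s _ => ?_
  rw [huφ, hvψ]
  simp only [hA]
  push_cast
  rw [add_mul, Complex.exp_add]
  ring

theorem isInterlaced_trisect_quadratic {θ m c b d : ℝ} (hθ : 0 ≤ θ) (hm : 0 < m) (hc : 0 < c)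
    (hb : 0 < b) (hd : 0 < d) {w : ℂ} (hw : w = m * cexp (θ * I)) :
    IsInterlaced θ (trisect (quadratic c b d) w) := by
  rw [trisect_quadratic]
  refine ⟨fun r => (if r = 0 then c else if r = 1 then b else d) * m ^ r.val,
    fun r => r.val * θ, fun r => ?_, fun r => ?_,
    fun r => ?_⟩
  · refine mul_pos ?_ (pow_pos hm _)
    split_ifs <;> assumption
  · beta_reduce
    rw [hw, mul_pow, ← Complex.exp_nat_mul, ofReal_mul, ofReal_pow, ofReal_mul, ofReal_natCast]
    ring_nf
  · have : ((r + 1).val : ℝ) ≤ r.val + 1 := by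
      exact_mod_cast (by revert r; decide : (r + 1).val ≤ r.val + 1)
    nlinarith

/-- The functions `q` such that multiplication by `q` preserves interlacing of the sections at `w`. -/
def interlacingMultipliers (θ : ℝ) (w : ℂ) : Submonoid (ℂ → ℂ) where
  carrier := {q | ∀ g, IsInterlaced θ (trisect g w) → IsInterlaced θ (trisect (q * g) w)}
  one_mem' := fun g hg => by rwa [one_mul]
  mul_mem' := fun {q q'} hq hq' g hg => by rw [mul_assoc]; exact hq _ (hq' _ hg)

theorem quadratic_mem_interlacingMultipliers {θ m c b d : ℝ} (hθ : 0 ≤ θ)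
    (hθ' : θ < Real.pi / 3) (hm : 0 < m) (hc : 0 ≤ c) (hb : 0 ≤ b) (hd : 0 ≤ d)
    (hpos : 0 < c + b + d) (hdisc : c * d ≤ b ^ 2) {w : ℂ} (hw : w = m * cexp (θ * I)) :
    quadratic c b d ∈ interlacingMultipliers θ w := fun g hg => by
  rw [funext (trisect_quadratic_mul c b d g w)]
  exact hg.quadratic_step hθ hθ' hm hc hb hd hpos hdisc hw

end Interlaced

/-! ### The product over the zeros and their multiplicities -/

section CanonicalProduct

variable {ι : Type*} {z : ι → ℂ}

theorem multipliable_one_sub_div (hsum : Summable fun i => 1 / ‖z i‖) (w : ℂ) :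
    Multipliable fun i => 1 - w / z i := by
  simp_rw [sub_eq_add_neg]
  refine multipliable_one_add_of_summable ((hsum.mul_left ‖w‖).congr fun i => ?_)
  rw [norm_neg, norm_div, mul_one_div]

theorem differentiable_tprod_one_sub_div (hsum : Summable fun i => 1 / ‖z i‖) :
    Differentiable ℂ fun w => ∏' i, (1 - w / z i) := by
  intro w₀
  have h := Summable.hasProdLocallyUniformlyOn_one_add (f := fun i (w : ℂ) => -(w / z i))
    (K := Metric.ball (0 : ℂ) (‖w₀‖ + 1)) Metric.isOpen_ball (hsum.mul_left (‖w₀‖ + 1))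
    (.of_forall fun i x hx => by
      rw [norm_neg, norm_div, mul_one_div]
      gcongr
      exact (mem_ball_zero_iff.1 hx).le) (fun i => by fun_prop)
  have hd := h.differentiableOn (.of_forall fun s => by
    simpa [Finset.prod_fn] using DifferentiableOn.finsetProd (fun _ _ => by fun_prop))
    Metric.isOpen_ball
  simp_rw [← sub_eq_add_neg] at hd
  exact hd.differentiableAt (Metric.isOpen_ball.mem_nhds (mem_ball_zero_iff.2 (by linarith)))

theorem tprod_one_sub_div_ne_zero (hz : ∀ i, z i ≠ 0) (hsum : Summable fun i => 1 / ‖z i‖) {w : ℂ}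
    (hw : ∀ i, z i ≠ w) : ∏' i, (1 - w / z i) ≠ 0 := by
  simp_rw [sub_eq_add_neg]
  refine tprod_one_add_ne_zero_of_summable (fun i h => hw i ?_)
    ((hsum.mul_left ‖w‖).congr fun i => ?_)
  · rw [← sub_eq_add_neg, sub_eq_zero, eq_div_iff (hz i), one_mul] at h
    exact h
  · rw [norm_neg, norm_div, mul_one_div]

theorem finite_norm_le (hz : ∀ i, z i ≠ 0) (hsum : Summable fun i => 1 / ‖z i‖) (R : ℝ) :
    {i | ‖z i‖ ≤ R}.Finite := by
  have hR : 0 < 1 / (|R| + 1) := by positivity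
  have h := hsum.tendsto_cofinite_zero.eventually (gt_mem_nhds hR)
  refine (eventually_cofinite.1 h).subset fun i hi hlt => ?_
  have h1 := (one_div_lt_one_div (norm_pos_iff.2 (hz i)) (by positivity)).1 hlt
  linarith [le_abs_self R, Set.mem_ofPred_eq.mp hi]

/-- The family `z` lists every zero of the product as often as its order. -/
theorem analyticOrderAt_tprod_one_sub_div (hz : ∀ i, z i ≠ 0)
    (hsum : Summable fun i => 1 / ‖z i‖) {ζ : ℂ} (hζ : ζ ≠ 0) :
    analyticOrderAt (fun w => ∏' i, (1 - w / z i)) ζ = {i | z i = ζ}.ncard := by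
  set s : Set ι := {i | z i = ζ} with hs
  have hfin : s.Finite := (finite_norm_le hz hsum ‖ζ‖).subset fun i (hi : z i = ζ) => by
    change ‖z i‖ ≤ ‖ζ‖
    rw [hi]
  have : Fintype s := hfin.fintype
  have hsum' : Summable fun i : ↑sᶜ => 1 / ‖z i‖ := hsum.subtype _
  rw [((differentiable_tprod_one_sub_div hsum).analyticAt ζ).analyticOrderAt_eq_natCast]
  refine ⟨fun w => (-ζ⁻¹) ^ s.ncard * ∏' i : ↑sᶜ, (1 - w / z i),
    analyticAt_const.mul ((differentiable_tprod_one_sub_div hsum').analyticAt ζ),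
    mul_ne_zero (pow_ne_zero _ (neg_ne_zero.2 (inv_ne_zero hζ)))
      (tprod_one_sub_div_ne_zero (z := fun i : ↑sᶜ => z i) (fun i => hz i) hsum' fun i => i.2),
    .of_forall fun w => ?_⟩
  have hprod : ∏' i : s, (1 - w / z i) = (1 - w / ζ) ^ s.ncard := by
    rw [tprod_fintype, Finset.prod_congr rfl fun (i : s) _ => by rw [i.2], Finset.prod_const,
      Finset.card_univ, ← Nat.card_eq_fintype_card, Nat.card_coe_set_eq]
  have hmul := Multipliable.tprod_mul_tprod_compl (f := fun i => 1 - w / z i) (s := s)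
    (multipliable_one_sub_div (hsum.subtype _) w) (multipliable_one_sub_div hsum' w)
  rw [smul_eq_mul, ← mul_assoc, ← mul_pow, ← hmul, hprod]
  congr 2
  field_simp
  ring

/-- The zeros of a real function come in conjugate pairs, with multiplicity. -/
theorem ncard_conj_eq_of_real {p : ℕ} {β : ℝ} {C : ℂ} (hz : ∀ i, z i ≠ 0)
    (hsum : Summable fun i => 1 / ‖z i‖) {f : ℂ → ℂ} (hreal : ∀ w, f (conj w) = conj (f w))
    (hfact : ∀ w, f w = w ^ p * cexp (β * w + C) * ∏' i, (1 - w / z i)) (ζ : ℂ) :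
    {i | z i = conj ζ}.ncard = {i | z i = ζ}.ncard := by
  rcases eq_or_ne ζ 0 with rfl | hζ
  · rw [map_zero]
  have hsum' : Summable fun i => 1 / ‖conj (z i)‖ := by simpa using hsum
  have hz' : ∀ i, conj (z i) ≠ 0 := fun i => (map_ne_zero _).2 (hz i)
  have hset : {i | z i = conj ζ} = {i | conj (z i) = ζ} := by
    ext i
    exact ⟨fun h => by simp [h.out], fun h => by simp [← h.out]⟩
  have hF : (fun w => ∏' i, (1 - w / z i)) =ᶠ[𝓝 ζ]
      (fun _ => cexp (conj C - C)) * fun w => ∏' i, (1 - w / conj (z i)) := by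
    filter_upwards [isOpen_ne.mem_nhds hζ] with w hw
    have h := hreal (conj w)
    rw [conj_conj, hfact w, hfact, map_mul, map_mul, map_pow, conj_conj,
      (multipliable_one_sub_div hsum _).map_tprod (starRingEnd ℂ) continuous_conj,
      ← exp_conj, map_add, map_mul, conj_conj, conj_ofReal, mul_assoc, mul_assoc] at h
    have h := mul_left_cancel₀ (pow_ne_zero p hw) h
    simp only [map_sub, map_one, map_div₀, conj_conj] at h
    have hne := Complex.exp_ne_zero (β * w + C)
    refine mul_left_cancel₀ hne ?_
    rw [h, Pi.mul_apply, ← mul_assoc, ← Complex.exp_add]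
    ring_nf
  have h1 := analyticOrderAt_tprod_one_sub_div hz hsum hζ
  rw [analyticOrderAt_congr hF, analyticOrderAt_mul analyticAt_const
      ((differentiable_tprod_one_sub_div hsum').analyticAt ζ),
    analyticAt_const.analyticOrderAt_eq_zero.2 (Complex.exp_ne_zero _), zero_add,
    analyticOrderAt_tprod_one_sub_div hz' hsum' hζ, ← hset] at h1
  exact_mod_cast h1

end CanonicalProduct

/-! ### Finite products over conjugation-invariant sets of zeros -/

section Pairing

theorem prod_mem_of_conj_symmetric {A : Type*} [CommMonoid A] (M : Submonoid A) {S : Finset ℂ}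
    (hS : ∀ ζ ∈ S, conj ζ ∈ S) {H : ℂ → A} (hreal : ∀ ζ ∈ S, ζ.im = 0 → H ζ ∈ M)
    (hpair : ∀ ζ ∈ S, 0 < ζ.im → H ζ * H (conj ζ) ∈ M) : ∏ ζ ∈ S, H ζ ∈ M := by
  rw [← Finset.prod_filter_mul_prod_filter_not S fun ζ => ζ.im = 0]
  refine M.mul_mem (M.prod_mem fun ζ hζ => ?_) ?_
  · rw [Finset.mem_filter] at hζ
    exact hreal ζ hζ.1 hζ.2
  rw [← Finset.prod_filter_mul_prod_filter_not _ fun ζ => 0 < ζ.im, Finset.filter_filter,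
    Finset.filter_filter]
  have hneg : ∏ ζ ∈ S with ζ.im ≠ 0 ∧ ¬ 0 < ζ.im, H ζ =
      ∏ ζ ∈ S with ζ.im ≠ 0 ∧ 0 < ζ.im, H (conj ζ) := by
    refine Finset.prod_nbij' conj conj ?_ ?_ (by simp) (by simp) (by simp)
    · intro ζ hζ
      rw [Finset.mem_filter] at hζ ⊢
      obtain ⟨h, h0, h1⟩ := hζ
      rw [conj_im]
      exact ⟨hS ζ h, neg_ne_zero.2 h0, neg_pos.2 (lt_of_le_of_ne (not_lt.1 h1) h0)⟩
    · intro ζ hζ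
      rw [Finset.mem_filter] at hζ ⊢
      obtain ⟨h, h0, h1⟩ := hζ
      rw [conj_im]
      exact ⟨hS ζ h, neg_ne_zero.2 h0, by linarith⟩
  rw [hneg, ← Finset.prod_mul_distrib]
  refine M.prod_mem fun ζ hζ => ?_
  rw [Finset.mem_filter] at hζ
  exact hpair ζ hζ.1 hζ.2.2

theorem re_le_of_mem_leftSector {ζ : ℂ} (hζ : ζ ∈ leftSector) : ζ.re ≤ -(‖ζ‖ / 2) := by
  have h1 : Real.cos ζ.arg ≤ -(1 / 2) := by
    have : Real.cos (2 * Real.pi / 3) = -(1 / 2) := by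
      rw [show 2 * Real.pi / 3 = Real.pi - Real.pi / 3 by ring, Real.cos_pi_sub,
        Real.cos_pi_div_three]
    rw [← this, ← Real.cos_abs ζ.arg]
    exact Real.cos_le_cos_of_nonneg_of_le_pi (by positivity) hζ.2 hζ.1.le
  have h2 := norm_mul_cos_arg ζ
  nlinarith [norm_nonneg ζ]

theorem ne_zero_of_mem_leftSector {ζ : ℂ} (hζ : ζ ∈ leftSector) : ζ ≠ 0 := by
  rintro rfl
  have := hζ.1
  rw [arg_zero, abs_zero] at this
  linarith [Real.pi_pos]

variable {θ m : ℝ} {w : ℂ}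

/-- Multiplication by the product of the factors `1 - u / z i` with `‖z i‖ ≤ R` preserves
interlacing, as the factors combine to real linear and quadratic polynomials. -/
theorem prod_one_sub_div_mem {ι : Type*} {z : ι → ℂ} (hθ : 0 ≤ θ) (hθ' : θ < Real.pi / 3)
    (hm : 0 < m) (hw : w = m * cexp (θ * I)) (hzs : ∀ i, z i ∈ leftSector)
    (hcount : ∀ ζ, {i | z i = conj ζ}.ncard = {i | z i = ζ}.ncard) {R : ℝ}
    (hR : {i | ‖z i‖ ≤ R}.Finite) :
    ∏ i ∈ hR.toFinset, (fun u => 1 - u / z i) ∈ interlacingMultipliers θ w := by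
  classical
  have hN : ∀ ζ ∈ hR.toFinset.image z,
      (hR.toFinset.filter fun i => z i = ζ).card = {i | z i = ζ}.ncard := by
    intro ζ hζ
    obtain ⟨j, hj, rfl⟩ := Finset.mem_image.1 hζ
    rw [← Set.ncard_coe_finset]
    congr 1
    ext i
    simp only [Finset.coe_filter, Set.Finite.mem_toFinset, Set.mem_ofPred_eq, and_iff_right_iff_imp]
    intro h
    rw [h]
    exact hR.mem_toFinset.1 hj
  rw [Finset.prod_comp (fun ζ : ℂ => fun u : ℂ => 1 - u / ζ) z,
    Finset.prod_congr rfl fun ζ hζ => by rw [hN ζ hζ]]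
  refine prod_mem_of_conj_symmetric _ ?_ ?_ ?_
  · intro ζ hζ
    obtain ⟨j, hj, rfl⟩ := Finset.mem_image.1 hζ
    have hpos : 0 < {i | z i = conj (z j)}.ncard := by
      rw [hcount, ← hN _ hζ]
      exact Finset.card_pos.2 ⟨j, Finset.mem_filter.2 ⟨hj, rfl⟩⟩
    obtain ⟨i, hi⟩ := Set.nonempty_of_ncard_ne_zero hpos.ne'
    refine Finset.mem_image.2 ⟨i, ?_, hi⟩
    rw [Set.Finite.mem_toFinset] at hj ⊢
    have hi' : z i = conj (z j) := hi
    change ‖z i‖ ≤ R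
    rw [hi', norm_conj]
    exact hj
  · intro ζ hζ him
    refine pow_mem ?_ _
    obtain ⟨j, hj, rfl⟩ := Finset.mem_image.1 hζ
    have hre := re_le_of_mem_leftSector (hzs j)
    have hn := norm_pos_iff.2 (ne_zero_of_mem_leftSector (hzs j))
    have heq : (fun u => 1 - u / z j) = quadratic 1 (-(z j).re⁻¹) 0 := by
      funext u
      have : z j = (z j).re := Complex.ext rfl (by simpa using him)
      rw [quadratic, this]
      push_cast
      simp only [ofReal_re]
      ring
    rw [heq]
    have : 0 < -(z j).re⁻¹ := neg_pos.2 (inv_lt_zero.2 (by linarith))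
    exact quadratic_mem_interlacingMultipliers hθ hθ' hm zero_le_one this.le le_rfl
      (by linarith) (by nlinarith) hw
  · intro ζ hζ _
    rw [hcount ζ, ← mul_pow]
    refine pow_mem ?_ _
    obtain ⟨j, hj, rfl⟩ := Finset.mem_image.1 hζ
    have hre := re_le_of_mem_leftSector (hzs j)
    have hne := ne_zero_of_mem_leftSector (hzs j)
    have hn := norm_pos_iff.2 hne
    have hN : 0 < normSq (z j) := normSq_pos.2 hne
    have heq : (fun u => 1 - u / z j) * (fun u => 1 - u / conj (z j)) =
        quadratic 1 (-(2 * (z j).re) / normSq (z j)) (1 / normSq (z j)) := by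
      funext u
      have hc : conj (z j) ≠ 0 := (map_ne_zero _).2 hne
      have h1 : z j + conj (z j) = ((2 * (z j).re : ℝ) : ℂ) := add_conj _
      have h2 : z j * conj (z j) = normSq (z j) := mul_conj _
      rw [quadratic, Pi.mul_apply]
      push_cast at h1 ⊢
      rw [← h1, ← h2]
      field_simp
      ring
    rw [heq]
    refine quadratic_mem_interlacingMultipliers hθ hθ' hm zero_le_one
      (div_nonneg (by linarith) hN.le) (by positivity) ?_ ?_ hw
    · have : 0 ≤ -(2 * (z j).re) / normSq (z j) := div_nonneg (by linarith) hN.le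
      positivity
    · rw [div_pow, one_mul, div_le_div_iff₀ hN (by positivity)]
      have : normSq (z j) = ‖z j‖ ^ 2 := normSq_eq_norm_sq _
      have h4 : normSq (z j) ≤ (-(2 * (z j).re)) ^ 2 := by nlinarith
      nlinarith

end Pairing

/-! ### The exponential function -/

section Exponential

variable {θ m : ℝ} {w : ℂ}

/-- For `u = δ w` with `‖u‖ ≤ 1`, the `s`-th section of the exponential series is dominated by its
first term `u ^ s / s!`, which has norm at least `‖u‖ ^ 2 / 2`. -/
theorem trisect_exp_ne_zero {δ : ℝ} (hδ : 0 < δ) (hw : w ≠ 0) (hδw : δ * ‖w‖ ≤ 1) (s : ZMod 3) :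
    trisect (fun u => cexp (δ * u)) w s ≠ 0 := by
  intro h0
  have hx : 0 < δ * ‖w‖ := mul_pos hδ (norm_pos_iff.2 hw)
  have hdiff : trisect (quadratic 1 δ (δ ^ 2 / 2)) w s =
      3⁻¹ * ∑ k, stdAddChar (k * s) * (quadratic 1 δ (δ ^ 2 / 2) (stdAddChar (-k) * w) -
        cexp (δ * (stdAddChar (-k) * w))) := by
    simp_rw [mul_sub]
    rw [Finset.sum_sub_distrib, mul_sub, ← trisect_apply,
      ← trisect_apply (fun u => cexp (δ * u)) w s, h0, sub_zero]
  have hup : ‖trisect (quadratic 1 δ (δ ^ 2 / 2)) w s‖ ≤ (δ * ‖w‖) ^ 3 * (2 / 9) := by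
    rw [hdiff, norm_mul]
    have hterm : ∀ k : ZMod 3, ‖stdAddChar (k * s) *
        (quadratic 1 δ (δ ^ 2 / 2) (stdAddChar (-k) * w) - cexp (δ * (stdAddChar (-k) * w)))‖ ≤
          (δ * ‖w‖) ^ 3 * (2 / 9) := by
      intro k
      have hn : ‖(δ : ℂ) * (stdAddChar (-k) * w)‖ = δ * ‖w‖ := by
        rw [norm_mul, norm_mul, AddChar.norm_apply, one_mul, norm_real, Real.norm_of_nonneg hδ.le]
      have hb := Complex.exp_bound (x := δ * (stdAddChar (-k) * w)) (hn.trans_le hδw) (n := 3)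
        (by norm_num)
      rw [hn, norm_sub_rev] at hb
      rw [norm_mul, AddChar.norm_apply, one_mul]
      convert! hb using 2
      · rw [quadratic, Finset.sum_range_succ, Finset.sum_range_succ, Finset.sum_range_one]
        simp [Nat.factorial]
        ring
      · norm_num [Nat.factorial]
    calc _ ≤ ‖(3⁻¹ : ℂ)‖ * ∑ k : ZMod 3, (δ * ‖w‖) ^ 3 * (2 / 9) := by
          gcongr
          exact norm_sum_le_of_le _ fun k _ => hterm k
      _ = _ := by
        rw [Finset.sum_const, Finset.card_univ, ZMod.card]
        norm_num
        ring
  have hlow : (δ * ‖w‖) ^ 2 / 2 ≤ ‖trisect (quadratic 1 δ (δ ^ 2 / 2)) w s‖ := by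
    rw [trisect_quadratic]
    have : s = 0 ∨ s = 1 ∨ s = 2 := (by decide : ∀ s : ZMod 3, s = 0 ∨ s = 1 ∨ s = 2) s
    rcases this with rfl | rfl | rfl
    · simp
      nlinarith
    · have hv : (1 : ZMod 3).val = 1 := rfl
      simp [hv, abs_of_pos hδ]
      nlinarith
    · have hv : (2 : ZMod 3).val = 2 := rfl
      have h2 : (2 : ZMod 3) ≠ 0 := by decide
      have h3 : (2 : ZMod 3) ≠ 1 := by decide
      simp [hv, h2, h3]
      nlinarith
  nlinarith [pow_pos hx 2]

theorem tendsto_quadratic_pow_exp (δ : ℝ) (u : ℂ) :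
    Tendsto (fun n : ℕ => (quadratic 1 (δ / n) 0 ^ n) u) atTop (𝓝 (cexp (δ * u))) := by
  refine (tendsto_one_add_div_pow_exp (δ * u)).congr fun n => ?_
  rw [Pi.pow_apply, quadratic]
  push_cast
  congr 1
  ring

/-- The exponent has to be at least `2`, since the polynomials `1` and `1 + δ z` have vanishing
sections. -/
theorem isInterlaced_trisect_quadratic_pow {δ : ℝ} (hθ : 0 ≤ θ) (hθ' : θ < Real.pi / 3)
    (hm : 0 < m) (hw : w = m * cexp (θ * I)) (hδ : 0 < δ) {n : ℕ} (hn : 2 ≤ n) :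
    IsInterlaced θ (trisect (quadratic 1 δ 0 ^ n) w) := by
  have hsq : quadratic 1 δ 0 ^ 2 = quadratic 1 (2 * δ) (δ ^ 2) := by
    funext u
    rw [Pi.pow_apply, quadratic, quadratic]
    push_cast
    ring
  rw [← Nat.sub_add_cancel hn, pow_add, hsq]
  exact pow_mem (quadratic_mem_interlacingMultipliers hθ hθ' hm zero_le_one hδ.le le_rfl
    (by linarith) (by nlinarith) hw) _ _
    (isInterlaced_trisect_quadratic hθ hm one_pos (by linarith) (pow_pos hδ 2) hw)

end Exponential

/-! ### Nonvanishing of the sections -/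

/-- The sections do not vanish in the sector `0 ≤ Arg w < π / 3`. -/
theorem trisect_ne_zero {ι : Type*} {z : ι → ℂ} (hsum : Summable fun i => 1 / ‖z i‖)
    (hzs : ∀ i, z i ∈ leftSector)
    (hcount : ∀ ζ, {i | z i = conj ζ}.ncard = {i | z i = ζ}.ncard) {β : ℝ} (hβ : 0 < β) (p : ℕ)
    {w : ℂ} (hw0 : w ≠ 0) (harg : 0 ≤ w.arg) (harg' : w.arg < Real.pi / 3) (r : ZMod 3) :
    trisect (fun u => u ^ p * cexp (β * u) * ∏' i, (1 - u / z i)) w r ≠ 0 := by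
  have hz : ∀ i, z i ≠ 0 := fun i => ne_zero_of_mem_leftSector (hzs i)
  have hm : 0 < ‖w‖ := norm_pos_iff.2 hw0
  have hw : w = ‖w‖ * cexp (w.arg * I) := (norm_mul_exp_arg_mul_I w).symm
  have hcos : 0 < Real.cos (3 * w.arg / 2) :=
    Real.cos_pos_of_mem_Ioo ⟨by linarith [Real.pi_pos], by linarith⟩
  set θ := w.arg
  -- split off a factor `exp (δ u)` whose sections at `w` are visibly nonzero
  obtain ⟨δ, hδ, hδβ, hδw⟩ : ∃ δ : ℝ, 0 < δ ∧ δ < β ∧ δ * ‖w‖ ≤ 1 := by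
    refine ⟨min (β / 2) (1 / ‖w‖), by positivity, (min_le_left _ _).trans_lt (by linarith), ?_⟩
    rw [← le_div_iff₀ hm]
    exact min_le_right _ _
  have hfin := finite_norm_le hz hsum
  set E : ℕ → ℂ → ℂ := fun n => quadratic 1 (δ / n) 0 ^ n
  set Q : ℕ → ℂ → ℂ := fun n => quadratic 0 1 0 ^ p *
    (∏ i ∈ (hfin n).toFinset, (fun u => 1 - u / z i)) * quadratic 1 ((β - δ) / n) 0 ^ n
  set Qlim : ℂ → ℂ := fun u => u ^ p * (∏' i, (1 - u / z i)) * cexp ((β - δ : ℝ) * u)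
  have hE : ∀ u, Tendsto (fun n => E n u) atTop (𝓝 (cexp (δ * u))) :=
    tendsto_quadratic_pow_exp δ
  have hQ : ∀ u, Tendsto (fun n => Q n u) atTop (𝓝 (Qlim u)) := by
    intro u
    have hs : Tendsto (fun n : ℕ => (hfin n).toFinset) atTop atTop := by
      refine tendsto_atTop_finset_of_monotone (fun a b hab => ?_) fun i => ?_
      · rw [Set.Finite.toFinset_subset_toFinset]
        intro i (hi : ‖z i‖ ≤ a)
        exact hi.trans (by exact_mod_cast hab)
      · obtain ⟨n, hn⟩ := exists_nat_ge ‖z i‖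
        exact ⟨n, (Set.Finite.mem_toFinset _).2 hn⟩
    refine ((tendsto_const_nhds.mul (((multipliable_one_sub_div hsum u).hasProd).comp hs)).mul
      (tendsto_quadratic_pow_exp (β - δ) u)).congr fun n => ?_
    simp [Q, quadratic, Finset.prod_apply]
  have hlim : (fun u => u ^ p * cexp (β * u) * ∏' i, (1 - u / z i)) =
      fun u => cexp (δ * u) * Qlim u := by
    funext u
    simp only [Qlim]
    rw [show (β : ℂ) * u = δ * u + (β - δ : ℝ) * u by push_cast; ring, Complex.exp_add]
    ring
  -- a zero `z i = w` would have `|Arg w| > 2π/3`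
  have hQw : Qlim w ≠ 0 := by
    refine mul_ne_zero (mul_ne_zero (pow_ne_zero _ hw0) ?_) (Complex.exp_ne_zero _)
    refine tprod_one_sub_div_ne_zero hz hsum fun i hi => ?_
    have h := (hzs i).1
    rw [hi, abs_of_nonneg harg] at h
    linarith [Real.pi_pos]
  obtain ⟨t, ht⟩ := exists_trisect_ne_zero hQw
  have hbound : ∀ᶠ n : ℕ in atTop, Real.cos (3 * θ / 2) *
      (‖trisect (E n) w (r - t)‖ * ‖trisect (Q n) w t‖) ≤ ‖trisect (E n * Q n) w r‖ := by
    filter_upwards [eventually_ge_atTop 2] with n hn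
    have hn0 : (0 : ℝ) < n := by exact_mod_cast (by omega : 0 < n)
    have h1 : IsInterlaced θ (trisect (E n) w) :=
      isInterlaced_trisect_quadratic_pow harg harg' hm hw (div_pos hδ hn0) hn
    have h2 : IsInterlaced θ (trisect (Q n) w) := by
      refine (interlacingMultipliers θ w).mul_mem (pow_mem ?_ p) ?_ _
        (isInterlaced_trisect_quadratic_pow harg harg' hm hw (div_pos (sub_pos.2 hδβ) hn0) hn)
      · exact quadratic_mem_interlacingMultipliers harg harg' hm le_rfl zero_le_one le_rfl
          (by norm_num) (by norm_num) hw
      · exact prod_one_sub_div_mem harg harg' hm hw hzs hcount (hfin n)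
    have := h1.cos_mul_le_norm_convolution harg' h2 r (r - t)
    rwa [sub_sub_cancel, ← trisect_mul] at this
  have key : Real.cos (3 * θ / 2) *
      (‖trisect (fun u => cexp (δ * u)) w (r - t)‖ * ‖trisect Qlim w t‖) ≤
        ‖trisect (fun u => cexp (δ * u) * Qlim u) w r‖ :=
    le_of_tendsto_of_tendsto
      (((tendsto_trisect hE w _).norm.mul (tendsto_trisect hQ w _).norm).const_mul _)
      (tendsto_trisect (fun u => (hE u).mul (hQ u)) w r).norm hbound
  rw [hlim, ← norm_pos_iff]
  exact lt_of_lt_of_le (mul_pos hcos (mul_pos (norm_pos_iff.2 (trisect_exp_ne_zero hδ hw0 hδw _))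
    (norm_pos_iff.2 ht))) key

/-! ### Sections of the power series and their symmetries -/

section ArithSection

variable {f : ℂ → ℂ} {a : ℕ → ℝ}

theorem trisect_eq_arithSection (hf : ∀ w : ℂ, HasSum (fun j : ℕ => (a j : ℂ) * w ^ j) (f w))
    (w : ℂ) : trisect f w = fun r => arithSection a 3 r.val w := by
  rw [trisect_eq_iff]
  intro k
  have hs : ∀ r : ZMod 3, Summable fun j : ℕ =>
      if j ≡ r.val [MOD 3] then (a j : ℂ) * w ^ j else 0 := fun r =>
    (hf w).summable.norm.of_norm_bounded fun j => by
      split_ifs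
      · exact le_rfl
      · rw [norm_zero]; exact norm_nonneg _
  have h := hasSum_sum (s := Finset.univ) fun (r : ZMod 3) _ =>
    ((hs r).hasSum.mul_left (stdAddChar (-(r * k)) : ℂ))
  refine h.unique ?_
  convert! hf (stdAddChar (-k) * w) using 2 with j
  have hj : ∀ r : ZMod 3, j ≡ r.val [MOD 3] ↔ (j : ZMod 3) = r := fun r => by
    rw [← ZMod.natCast_eq_natCast_iff, ZMod.natCast_zmod_val]
  have hχ : (stdAddChar (-((j : ZMod 3) * k)) : ℂ) = stdAddChar (-k) ^ j := by
    rw [← AddChar.map_nsmul_eq_pow, nsmul_eq_mul, mul_neg]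
  simp_rw [hj]
  rw [Finset.sum_eq_single (j : ZMod 3) (fun r _ hr => by rw [if_neg hr.symm, mul_zero])
    fun h => absurd (Finset.mem_univ _) h, if_pos rfl, hχ, mul_pow]
  ring

theorem arithSection_conj (a : ℕ → ℝ) (m r : ℕ) (w : ℂ) :
    arithSection a m r (conj w) = conj (arithSection a m r w) := by
  rw [arithSection, arithSection, conj_tsum]
  refine tsum_congr fun j => ?_
  split_ifs <;> simp

theorem arithSection_eq_zero_of_pow_eq {m r : ℕ} {w w' : ℂ} (hw : w ≠ 0)
    (h : w' ^ m = w ^ m) (hr : r < m) (h0 : arithSection a m r w = 0) :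
    arithSection a m r w' = 0 := by
  have : arithSection a m r w' = (w' / w) ^ r * arithSection a m r w := by
    rw [arithSection, arithSection, ← tsum_mul_left]
    refine tsum_congr fun j => ?_
    split_ifs with hj
    · have hj' : j = r + m * (j / m) := by
        conv_lhs => rw [← Nat.mod_add_div j m, hj, Nat.mod_eq_of_lt hr]
      rw [hj', pow_add, pow_add, pow_mul, pow_mul, h, div_pow]
      field_simp
    · simp
  rw [this, h0, mul_zero]

theorem exists_pow_three_eq_of_notMem_cubicRays {w : ℂ} (h : w ∉ cubicRays) :
    ∃ w', w' ≠ 0 ∧ w' ^ 3 = w ^ 3 ∧ |w'.arg| < Real.pi / 3 := by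
  have hslit : w ^ 3 ∈ slitPlane := by
    rw [mem_slitPlane_iff]
    by_contra! h'
    exact h ⟨h'.2, h'.1⟩
  obtain ⟨harg, hne⟩ := mem_slitPlane_iff_arg.1 hslit
  have h1 := neg_pi_lt_arg (w ^ 3)
  have h2 := lt_of_le_of_ne (arg_le_pi (w ^ 3)) harg
  have him : (log (w ^ 3) / 3).im = (w ^ 3).arg / 3 := by
    rw [← log_im]
    exact div_ofNat_im _ 3
  have harg' : (cexp (log (w ^ 3) / 3)).arg = (w ^ 3).arg / 3 := by
    rw [← log_im, log_exp (by rw [him]; linarith) (by rw [him]; linarith), him]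
  refine ⟨cexp (log (w ^ 3) / 3), Complex.exp_ne_zero _, ?_, ?_⟩
  · rw [← Complex.exp_nat_mul, Nat.cast_ofNat, mul_div_cancel₀ _ three_ne_zero, exp_log hne]
  · rw [harg', abs_lt]
    constructor <;> linarith

end ArithSection

theorem theorem3 {ι : Type*} (f : ℂ → ℂ) (a : ℕ → ℝ)
    -- `f` is a real entire function, with Taylor coefficients `a j`
    (hf : ∀ w : ℂ, HasSum (fun j : ℕ => (a j : ℂ) * w ^ j) (f w))
    -- its Weierstrass factorization; the family `z` may be empty, finite or infinite
    (p : ℕ) (B C : ℂ) (z : ι → ℂ) (hz : ∀ i, z i ≠ 0)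
    (hsum : Summable fun i => 1 / ‖z i‖)
    (hfact : ∀ w : ℂ, f w = w ^ p * Complex.exp (B * w + C) *
      ∏' i, (1 - w / z i) * Complex.exp (w / z i))
    -- the zeros, apart from the origin when `p` is positive, lie in the sector
    (hzeros : ∀ w : ℂ, w ≠ 0 → f w = 0 → w ∈ leftSector)
    -- the order of the complex numbers: the sum is real and positive
    (hB : 0 < B + ∑' i, 1 / z i) :
    ∀ r < 3, ∀ w : ℂ, arithSection a 3 r w = 0 → w ∈ cubicRays := by
  intro r hr w h0
  by_contra hw
  -- since `∑ 1 / |z i|` converges, the exponential factors of the product combine to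
  -- `exp (w ∑ 1 / z i)`, which leaves `exp (β w)` and a product of genus zero
  obtain ⟨β, hβ, hβB⟩ : ∃ β : ℝ, 0 < β ∧ (β : ℂ) = B + ∑' i, 1 / z i :=
    ⟨_, (pos_iff.1 hB).1, Complex.ext rfl (pos_iff.1 hB).2⟩
  have hsum' : Summable fun i => 1 / z i :=
    Summable.of_norm (by simpa using hsum)
  have hfact' : ∀ w, f w = w ^ p * cexp (β * w + C) * ∏' i, (1 - w / z i) := by
    intro w
    have hexp : HasProd (fun i => cexp (w / z i)) (cexp (w * ∑' i, 1 / z i)) := by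
      have := (hsum'.hasSum.mul_left w).cexp
      simpa only [Function.comp_def, mul_one_div] using this
    rw [hfact w, (multipliable_one_sub_div hsum w).tprod_mul hexp.multipliable, hexp.tprod_eq,
      show (β : ℂ) * w + C = (B * w + C) + w * ∑' i, 1 / z i by rw [hβB]; ring,
      Complex.exp_add _ (w * _)]
    ring
  have hzs : ∀ i, z i ∈ leftSector := fun i => by
    refine hzeros _ (hz i) ?_
    rw [hfact', tprod_of_exists_eq_zero ⟨i, by rw [div_self (hz i), sub_self]⟩, mul_zero]
  have hreal : ∀ w, f (conj w) = conj (f w) := fun w => by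
    refine (hf (conj w)).unique ?_
    simpa [Function.comp_def] using (hf w).map (starRingEnd ℂ) continuous_conj
  have hcount := ncard_conj_eq_of_real hz hsum hreal hfact'
  have hw0 : w ≠ 0 := by
    rintro rfl
    exact hw (by simp [cubicRays])
  obtain ⟨v, hv0, hv3, hvarg⟩ := exists_pow_three_eq_of_notMem_cubicRays hw
  have hv : arithSection a 3 r v = 0 := arithSection_eq_zero_of_pow_eq hw0 hv3 hr h0
  obtain ⟨u, hu0, hu, harg, harg'⟩ : ∃ u, u ≠ 0 ∧ arithSection a 3 r u = 0 ∧ 0 ≤ u.arg ∧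
      u.arg < Real.pi / 3 := by
    rcases le_or_gt 0 v.arg with h | h
    · exact ⟨v, hv0, hv, h, (abs_lt.1 hvarg).2⟩
    · have hc : (conj v).arg = -v.arg := by
        rw [arg_conj, if_neg]
        intro hpi
        linarith [Real.pi_pos]
      refine ⟨conj v, (map_ne_zero _).2 hv0, ?_, ?_, ?_⟩
      · rw [arithSection_conj, hv, map_zero]
      · rw [hc]; linarith
      · rw [hc]; linarith [(abs_lt.1 hvarg).1]
  refine trisect_ne_zero hsum hzs hcount hβ p hu0 harg harg' (r : ZMod 3) ?_
  have hg : f = fun u => cexp C * (u ^ p * cexp (β * u) * ∏' i, (1 - u / z i)) := by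
    funext u
    rw [hfact', Complex.exp_add]
    ring
  have hfu : trisect f u r = 0 := by
    rw [trisect_eq_arithSection hf]
    beta_reduce
    rw [ZMod.val_natCast_of_lt hr, hu]
  rw [trisect_apply] at hfu ⊢
  rw [hg] at hfu
  simp_rw [mul_left_comm _ (cexp C)] at hfu
  rw [← Finset.mul_sum, mul_left_comm] at hfu
  exact (mul_eq_zero.1 hfu).resolve_left (Complex.exp_ne_zero C)
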